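/- Let $n\ge 2$ and let $T\subset\mathbb{R}^{n+1}$ be a regular polytope centred at the origin, that is, a convex polytope with nonempty interior whose symmetry group $\mathcal S(T)=\{g\in O(n+1): g(T)=T\}$ acts transitively on the flags (maximal chains of proper faces) of $T$. Let $K\subset\mathbb{R}^{n+1}$ be a convex body (compact, convex, with nonempty interior) whose support function $h_K(x)=\max_{z\in K}\langle z,x\rangle$, $x\in\mathbb{S}^n$, is of class $C^2$ on $\mathbb{S}^n$ and invariant under $\mathcal S(T)$, i.e. $h_K(gx)=h_K(x)$ for all $g\in\mathcal S(T)$ and $x\in\mathbb{S}^n$. Put $$dV_K=h_K\det(\nabla^2h_K+h_KI)\,d\sigma,\qquad d\sigma=d\mathcal H^n|_{\mathbb{S}^n},$$ where $\nabla^2h_K$ is the covariant Hessian on $\mathbb{S}^n$, written in an orthonormal frame. Then $h_K^{-2}$ is integrable with respect to $dV_K$, and the coordinate functions $x_1,\dots,x_{n+1}$ satisfy $$\int_{\mathbb{S}^n}\frac{x_\alpha x_\beta}{h_K^{2}}\,dV_K=\frac{\delta_{\alpha\beta}}{n+1}\int_{\mathbb{S}^n}h_K^{-2}\,dV_K\qquad\text{for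 all }\alpha,\beta=1,\dots,n+1.$$ -/

import Mathlib

open MeasureTheory Metric
open scoped RealInnerProductSpace

noncomputable section

namespace StronglySymmetric

/-! ### Regular polytopes and their symmetry groups -/

section Polytope

variable {E : Type*} [NormedAddCommGroup E] [InnerProductSpace ℝ E]

/-- `T` is a full-dimensional convex polytope: the convex hull of finitely many points, with
nonempty interior. -/
def IsPolytope (T : Set E) : Prop :=
  (∃ V : Set E, V.Finite ∧ T = convexHull ℝ V) ∧ (interior T).Nonempty

/-- The symmetry group of `T` inside the orthogonal group of `E`: all linear isometries of `E`
that map `T` onto itself. -/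
def symmetryGroup (T : Set E) : Subgroup (E ≃ₗᵢ[ℝ] E) where
  carrier := {g | g '' T = T}
  mul_mem' := by
    intro a b ha hb
    simp only [Set.mem_ofPred_eq] at ha hb ⊢
    have h : (⇑(a * b) : E → E) = a ∘ b := rfl
    rw [h, Set.image_comp, hb, ha]
  one_mem' := by
    simp only [Set.mem_ofPred_eq]
    have h : (⇑(1 : E ≃ₗᵢ[ℝ] E) : E → E) = id := rfl
    rw [h, Set.image_id]
  inv_mem' := by
    intro a ha
    simp only [Set.mem_ofPred_eq] at ha ⊢
    conv_lhs => rw [← ha]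
    rw [← Set.image_comp]
    have h : ((⇑(a⁻¹ : E ≃ₗᵢ[ℝ] E) : E → E) ∘ a) = id := by
      funext x
      exact a.symm_apply_apply x
    rw [h, Set.image_id]

/-- `F` is a proper face of the polytope `T`: nonempty, different from `T`, and the set of points
of `T` at which some linear functional attains its maximum over `T`. -/
def IsProperFace (T F : Set E) : Prop :=
  IsExposed ℝ T F ∧ F.Nonempty ∧ F ≠ T

/-- A flag of `T`: a maximal chain of proper faces, ordered by inclusion. -/
def IsFlag (T : Set E) (Φ : Set (Set E)) : Prop :=
  Maximal (fun C : Set (Set E) => IsChain (· ⊆ ·) C ∧ ∀ F ∈ C, IsProperFace T F) Φ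

/-- `T` is a regular polytope centred at the origin: a full-dimensional convex polytope whose
symmetry group in the orthogonal group acts transitively on flags. (The center of mass of the
vertices is fixed by these linear isometries, and flag-transitivity then forces it to be `0`;
conversely, every isometry of a polytope centred at `0` is linear.) -/
def IsRegularPolytope (T : Set E) : Prop :=
  IsPolytope T ∧ ∀ Φ Ψ : Set (Set E), IsFlag T Φ → IsFlag T Ψ →
    ∃ g ∈ symmetryGroup T, (fun F : Set E => g '' F) '' Φ = Ψ

end Polytope

/-! ### Calculus on the unit sphere -/

section Sphere

variable {E : Type*} [NormedAddCommGroup E] [InnerProductSpace ℝ E]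

/-- The extension of a function on the unit sphere to `E \ {0}` that is constant along rays. Only
the values of `f` on the unit sphere matter away from the origin. -/
def radialExtension (f : E → ℝ) (y : E) : ℝ := f (‖y‖⁻¹ • y)

/-- The restriction of `f` to the unit sphere is of class `C²`. -/
def IsC2OnSphere (f : E → ℝ) : Prop :=
  ContDiffOn ℝ 2 (radialExtension f) {0}ᶜ

/-- The covariant Hessian `∇²f (u, v)` of `f` at the point `x` of the unit sphere, for vectors
`u`, `v` tangent to the sphere at `x`. The Euclidean gradient of the radial extension restricts on
the sphere to the Riemannian gradient `∇f`, and the Levi-Civita derivative of a tangent field is the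
tangential part of its Euclidean derivative, so that `∇²f (u, v) = ⟨D_u ∇f, v⟩` is the second
Euclidean derivative of the radial extension in the directions `u`, `v`. -/
def sphereHessian (f : E → ℝ) (x u v : E) : ℝ :=
  fderiv ℝ (fderiv ℝ (radialExtension f)) x u v

variable [FiniteDimensional ℝ E]

/-- The determinant `det (∇²f + f I)` at the point `x` of the unit sphere, computed in an
orthonormal basis of the tangent space `x^⊥` (its value does not depend on the basis). -/
def detHessian (f : E → ℝ) (x : E) : ℝ :=
  let e := stdOrthonormalBasis ℝ (ℝ ∙ x)ᗮ
  (Matrix.of fun i j =>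
    sphereHessian f x (e i) (e j) + f x * (if i = j then 1 else 0)).det

end Sphere

/-! ### Convex bodies -/

section Body

variable {n : ℕ}

/-- The support function `h_K x = sup {⟨z, x⟩ | z ∈ K}`. -/
def supportFn (K : ConvexBody (EuclideanSpace ℝ (Fin (n + 1))))
    (x : EuclideanSpace ℝ (Fin (n + 1))) : ℝ :=
  sSup ((fun z => ⟪z, x⟫) '' (K : Set (EuclideanSpace ℝ (Fin (n + 1)))))

/-- The support function of `K`, as a function on the unit sphere, is invariant under the symmetry
group of `T`. -/
def IsStronglySymmetric (T : Set (EuclideanSpace ℝ (Fin (n + 1))))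
    (K : ConvexBody (EuclideanSpace ℝ (Fin (n + 1)))) : Prop :=
  ∀ g ∈ symmetryGroup T, ∀ x ∈ sphere (0 : EuclideanSpace ℝ (Fin (n + 1))) 1,
    supportFn K (g x) = supportFn K x

/-- The surface measure `dσ` of the unit sphere of `ℝ^(n+1)`: the `n`-dimensional Hausdorff measure
(normalized to agree with Lebesgue measure on `ℝ^n`) restricted to the sphere. -/
def sphereMeasure (n : ℕ) : Measure (EuclideanSpace ℝ (Fin (n + 1))) :=
  μHE[n].restrict (sphere (0 : EuclideanSpace ℝ (Fin (n + 1))) 1)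

/-- The measure `dV_K = h_K det (∇²h_K + h_K I) dσ`, for a convex body `K` with the origin in its
interior and with a support function of class `C²` (the density is then nonnegative and continuous
on the sphere). -/
def coneMeasure (K : ConvexBody (EuclideanSpace ℝ (Fin (n + 1)))) :
    Measure (EuclideanSpace ℝ (Fin (n + 1))) :=
  (sphereMeasure n).withDensity fun x =>
    ENNReal.ofReal (supportFn K x * detHessian (supportFn K) x)

end Body

end StronglySymmetric

end

/-! The integrals of `x α * x β / h_K ^ 2` are the matrix entries of the symmetric operator M u = ∫
h_K⁻² ⟪u, x⟫ x dV_K. Surface measure, h_K and det(∇²h_K + h_K I) are invariant under the symmetries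
of T, so M commutes with them. Such an operator is scalar
(`IsRegularPolytope.exists_eq_smul_of_commute`), and its trace fixes the scalar because |x| = 1 on
the sphere.

Scalarity comes from flags. Let u be normal to a facet (maximal proper face) F. Then M u is fixed by
the stabilizer of F. The functional ⟪M u, ·⟫ attains its maximum and its minimum over F on minimal
faces of T inside F, and the stabilizer carries one of these to the other. Hence the functional is
constant on F, and M u = c u. Transitivity on facets gives the same c for every facet normal, and
the normals span.

Integrability needs a positive lower bound for h_K. If z is fixed by all symmetries, the scalar
theorem applied to x ↦ ⟪z, x⟫ z forces z = 0. A closed convex invariant nonempty set therefore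
contains 0, its point of least norm being fixed; applied to the centres of balls of a given radius
inside K, this puts such a ball around the origin. A bounded density and the finite area of the
sphere do the rest. -/

namespace StronglySymmetric

/-! ### Exposed faces of a polytope and their normals -/

section PolytopeFaces

variable {E : Type*} [NormedAddCommGroup E] [InnerProductSpace ℝ E]

/-- The points of `T` at which the functional `⟪u, ·⟫` attains its maximum over `T`. -/
def faceOf (T : Set E) (u : E) : Set E := {x ∈ T | ∀ y ∈ T, ⟪u, y⟫ ≤ ⟪u, x⟫}

lemma isExposed_faceOf (T : Set E) (u : E) : IsExposed ℝ T (faceOf T u) :=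
  fun _ => ⟨innerSL ℝ u, rfl⟩

lemma IsProperFace.exists_normal [CompleteSpace E] {T F : Set E} (h : IsProperFace T F) :
    ∃ u, F = faceOf T u := by
  obtain ⟨l, hl⟩ := h.1 h.2.1
  refine ⟨(InnerProductSpace.toDual ℝ E).symm l, ?_⟩
  simpa [faceOf] using hl

lemma inner_eq_of_mem_faceOf {T : Set E} {u x y : E} (hx : x ∈ faceOf T u)
    (hy : y ∈ faceOf T u) : ⟪u, x⟫ = ⟪u, y⟫ :=
  le_antisymm (hy.2 x hx.1) (hx.2 y hy.1)

lemma mem_faceOf_of_inner_eq {T : Set E} {u x y : E} (hx : x ∈ faceOf T u) (hy : y ∈ T)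
    (h : ⟪u, y⟫ = ⟪u, x⟫) : y ∈ faceOf T u :=
  ⟨hy, fun z hz => (hx.2 z hz).trans_eq h.symm⟩

lemma inner_le_of_mem_convexHull {V : Set E} {m : E} {c : ℝ} (h : ∀ v ∈ V, ⟪m, v⟫ ≤ c)
    {x : E} (hx : x ∈ convexHull ℝ V) : ⟪m, x⟫ ≤ c := by
  have : convexHull ℝ V ⊆ {x | innerSL ℝ m x ≤ c} :=
    convexHull_min (fun v hv => h v hv)
      (convex_halfSpace_le (innerSL ℝ m).toLinearMap.isLinear c)
  exact this hx

/-- In a convex combination that attains the bound c, the nonnegative terms w i * (c - ⟪m, z i⟫) sum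
to zero, so every point with nonzero weight lies on the hyperplane. -/
lemma mem_convexHull_of_inner_eq {V : Set E} {m : E} {c : ℝ} (h : ∀ v ∈ V, ⟪m, v⟫ ≤ c)
    {x : E} (hx : x ∈ convexHull ℝ V) (hxc : ⟪m, x⟫ = c) :
    x ∈ convexHull ℝ {v ∈ V | ⟪m, v⟫ = c} := by
  obtain ⟨ι, _, w, z, hw₀, hw₁, hz, rfl⟩ := mem_convexHull_iff_exists_fintype.1 hx
  have hsum : ∑ i, w i * (c - ⟪m, z i⟫) = 0 := by
    simp only [mul_sub, Finset.sum_sub_distrib, ← Finset.sum_mul, hw₁]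
    rw [inner_sum] at hxc
    simp only [inner_smul_right] at hxc
    linarith
  have hzero := (Finset.sum_eq_zero_iff_of_nonneg fun i _ =>
    mul_nonneg (hw₀ i) (sub_nonneg.2 (h _ (hz i)))).1 hsum
  classical
  rw [← Finset.centerMass_eq_of_sum_1 _ _ hw₁, ← Finset.centerMass_filter_ne_zero]
  refine Finset.centerMass_mem_convexHull _ (fun i _ => hw₀ i) ?_ fun i hi => ⟨hz i, ?_⟩
  · rw [Finset.sum_filter_ne_zero, hw₁]
    exact one_pos
  · have := (mul_eq_zero.1 (hzero i (Finset.mem_univ i))).resolve_left (Finset.mem_filter.1 hi).2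
    linarith

lemma eq_zero_of_mem_interior_of_max {T : Set E} {u p : E} (hp : p ∈ interior T)
    (h : ∀ y ∈ T, ⟪u, y⟫ ≤ ⟪u, p⟫) : u = 0 := by
  have hc : Filter.Tendsto (fun t : ℝ => p + t • u) (nhds 0) (nhds p) := by
    have : Continuous (fun t : ℝ => p + t • u) := by fun_prop
    simpa using this.tendsto 0
  have hev := (hc.eventually (mem_interior_iff_mem_nhds.1 hp))
  obtain ⟨ε, hε, hball⟩ := Metric.eventually_nhds_iff.1 hev
  have h1 := h _ (hball (y := ε / 2) (by rw [Real.dist_eq, sub_zero, abs_of_pos (half_pos hε)]; linarith))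
  rw [inner_add_right, inner_smul_right, real_inner_self_eq_norm_sq] at h1
  have : ‖u‖ ^ 2 ≤ 0 := by
    by_contra! hpos
    nlinarith
  simpa using le_antisymm this (sq_nonneg _)

lemma eq_zero_of_inner_const {T : Set E} (hT : (interior T).Nonempty) {u : E} {c : ℝ}
    (h : ∀ y ∈ T, ⟪u, y⟫ = c) : u = 0 := by
  obtain ⟨p, hp⟩ := hT
  exact eq_zero_of_mem_interior_of_max hp
    fun y hy => (h y hy).trans_le (h p (interior_subset hp)).ge

lemma faceOf_ne_self {T : Set E} (hT : (interior T).Nonempty) {u : E} (hu : u ≠ 0) :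
    faceOf T u ≠ T := by
  intro h
  obtain ⟨p, hp⟩ := hT
  have hp' : p ∈ faceOf T u := by rw [h]; exact interior_subset hp
  exact hu (eq_zero_of_mem_interior_of_max hp hp'.2)

lemma IsPolytope.isCompact {T : Set E} (hT : IsPolytope T) : IsCompact T := by
  obtain ⟨⟨V, hV, rfl⟩, -⟩ := hT
  exact hV.isCompact_convexHull (𝕜 := ℝ)

lemma IsPolytope.convex {T : Set E} (hT : IsPolytope T) : Convex ℝ T := by
  obtain ⟨⟨V, hV, rfl⟩, -⟩ := hT
  exact convex_convexHull ℝ V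

lemma IsPolytope.faceOf_nonempty {T : Set E} (hT : IsPolytope T) (u : E) :
    (faceOf T u).Nonempty := by
  obtain ⟨x, hx, hmax⟩ := hT.isCompact.exists_isMaxOn (hT.2.mono interior_subset)
    (f := fun x => ⟪u, x⟫) (by fun_prop)
  exact ⟨x, hx, fun y hy => hmax hy⟩

lemma IsPolytope.isProperFace_faceOf {T : Set E} (hT : IsPolytope T) {u : E} (hu : u ≠ 0) :
    IsProperFace T (faceOf T u) :=
  ⟨isExposed_faceOf T u, hT.faceOf_nonempty u, faceOf_ne_self hT.2 hu⟩

lemma convexHull_inter_faceOf (V : Set E) (u : E) :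
    convexHull ℝ (V ∩ faceOf (convexHull ℝ V) u) = faceOf (convexHull ℝ V) u := by
  have hexp : Convex ℝ (faceOf (convexHull ℝ V) u) := (isExposed_faceOf (convexHull ℝ V) u).convex (convex_convexHull ℝ V)
  refine Set.Subset.antisymm (convexHull_min Set.inter_subset_right hexp) fun x hx => ?_
  refine convexHull_mono ?_ (mem_convexHull_of_inner_eq
    (fun v hv => hx.2 v (subset_convexHull ℝ V hv)) hx.1 rfl)
  exact fun v hv => ⟨hv.1, mem_faceOf_of_inner_eq hx (subset_convexHull ℝ V hv.1) hv.2⟩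

/-- A face is the hull of the points of V it contains, so finitely many subsets of V account for all
faces. Finiteness is what provides maximal and minimal proper faces. -/
lemma IsPolytope.finite_properFaces [CompleteSpace E] {T : Set E} (hT : IsPolytope T) :
    {F | IsProperFace T F}.Finite := by
  obtain ⟨⟨V, hV, rfl⟩, -⟩ := hT
  refine (hV.finite_subsets.image (convexHull ℝ)).subset fun F hF => ?_
  obtain ⟨u, rfl⟩ := IsProperFace.exists_normal hF
  exact ⟨_, Set.inter_subset_left, convexHull_inter_faceOf V u⟩

/-- A functional that is constant on a maximal proper face is a multiple of its normal. -/
lemma IsPolytope.eq_smul_of_inner_const {T : Set E} (hT : IsPolytope T) {l m : E} {b : ℝ}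
    (hF : Maximal (IsProperFace T) (faceOf T l)) (hm : ∀ x ∈ faceOf T l, ⟪m, x⟫ = b) :
    ∃ c : ℝ, m = c • l := by
  obtain ⟨x₀, hx₀⟩ := hF.1.2.1
  obtain ⟨⟨V, hV, hTV⟩, hint⟩ := id hT
  have hVT : V ⊆ T := hTV ▸ subset_convexHull ℝ V
  have key : ∀ m : E, ∀ b : ℝ, (∀ x ∈ faceOf T l, ⟪m, x⟫ = b) → (∃ v ∈ V, b < ⟪m, v⟫) →
      ∃ c : ℝ, m = c • l := by
    intro m b hm hv
    have hlt : ∀ v ∈ V, b < ⟪m, v⟫ → ⟪l, v⟫ < ⟪l, x₀⟫ := by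
      intro v hv hbv
      refine lt_of_le_of_ne (hx₀.2 v (hVT hv)) fun h => ?_
      exact hbv.ne' (hm v (mem_faceOf_of_inner_eq hx₀ (hVT hv) h))
    -- Tilt l towards m until the supporting hyperplane first meets a point of V with ⟪m, v⟫ > b:
    -- the smallest ratio t is that moment. The face of l + t • m then contains the old one and also
    -- v₀, against maximality, unless l + t • m = 0.
    obtain ⟨v₀, hv₀, hmin⟩ := Set.exists_min_image {v ∈ V | b < ⟪m, v⟫}
      (fun v => (⟪l, x₀⟫ - ⟪l, v⟫) / (⟪m, v⟫ - b)) (hV.subset (Set.sep_subset _ _)) hv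
    set t := (⟪l, x₀⟫ - ⟪l, v₀⟫) / (⟪m, v₀⟫ - b) with ht
    have hd₀ : 0 < ⟪m, v₀⟫ - b := by linarith [hv₀.2]
    have htpos : 0 < t := div_pos (by linarith [hlt v₀ hv₀.1 hv₀.2]) hd₀
    have hle : ∀ v ∈ V, ⟪l + t • m, v⟫ ≤ ⟪l, x₀⟫ + t * b := by
      intro v hv
      rw [inner_add_left, real_inner_smul_left]
      by_cases hbv : b < ⟪m, v⟫
      · have := hmin v ⟨hv, hbv⟩
        rw [le_div_iff₀ (by linarith)] at this
        linarith
      · have := hx₀.2 v (hVT hv)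
        nlinarith
    have hleT : ∀ y ∈ T, ⟪l + t • m, y⟫ ≤ ⟪l, x₀⟫ + t * b := fun y hy =>
      inner_le_of_mem_convexHull hle (hTV ▸ hy)
    have hsub : faceOf T l ⊆ faceOf T (l + t • m) := by
      intro x hx
      refine ⟨hx.1, fun y hy => (hleT y hy).trans_eq ?_⟩
      rw [inner_add_left, real_inner_smul_left, hm x hx, inner_eq_of_mem_faceOf hx hx₀]
    have hv₀mem : v₀ ∈ faceOf T (l + t • m) := by
      refine ⟨hVT hv₀.1, fun y hy => (hleT y hy).trans_eq ?_⟩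
      rw [inner_add_left, real_inner_smul_left, ht]
      field_simp
      ring
    by_cases h0 : l + t • m = 0
    · refine ⟨-t⁻¹, ?_⟩
      have : l = -(t • m) := eq_neg_of_add_eq_zero_left h0
      rw [this, smul_neg, neg_smul, neg_neg, smul_smul, inv_mul_cancel₀ htpos.ne', one_smul]
    · have := hF.2 (hT.isProperFace_faceOf h0) hsub hv₀mem
      exact absurd (hm v₀ this) hv₀.2.ne'
  by_cases h1 : ∃ v ∈ V, b < ⟪m, v⟫
  · exact key m b hm h1
  by_cases h2 : ∃ v ∈ V, ⟪m, v⟫ < b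
  · obtain ⟨c, hc⟩ := key (-m) (-b) (fun x hx => by rw [inner_neg_left, hm x hx])
      (by obtain ⟨v, hv, h⟩ := h2; exact ⟨v, hv, by rw [inner_neg_left]; linarith⟩)
    exact ⟨-c, by rw [neg_smul, ← hc, neg_neg]⟩
  -- Here m equals b on all of V, hence on T, and the nonempty interior forces m = 0.
  · push Not at h1 h2
    refine ⟨0, ?_⟩
    rw [zero_smul]
    refine eq_zero_of_inner_const hint (c := b) fun y hy => ?_
    rw [hTV] at hy
    refine le_antisymm (inner_le_of_mem_convexHull h1 hy) ?_
    have := inner_le_of_mem_convexHull (m := -m) (c := -b)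
      (fun v hv => by rw [inner_neg_left]; linarith [h2 v hv]) hy
    rw [inner_neg_left] at this
    linarith

/-- Every functional attains its maximum over a proper face on a smaller proper face. -/
lemma IsPolytope.exists_subface_max {T : Set E} (hT : IsPolytope T) {l : E}
    (hF : IsProperFace T (faceOf T l)) (m : E) :
    ∃ F, IsProperFace T F ∧ F ⊆ faceOf T l ∧
      ∃ b, (∀ y ∈ F, ⟪m, y⟫ = b) ∧ ∀ y ∈ faceOf T l, ⟪m, y⟫ ≤ b := by
  obtain ⟨⟨V, hV, hTV⟩, hint⟩ := id hT
  have hVT : V ⊆ T := hTV ▸ subset_convexHull ℝ V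
  have hcl : IsCompact (faceOf T l) := (isExposed_faceOf T l).isCompact hT.isCompact
  obtain ⟨x₀, hx₀, hmax⟩ := hcl.exists_isMaxOn hF.2.1 (f := fun x => ⟪m, x⟫) (by fun_prop)
  have hmax : ∀ y ∈ faceOf T l, ⟪m, y⟫ ≤ ⟪m, x₀⟫ := fun y hy => hmax hy
  -- For a small tilt ε the finitely many points of V off the face stay strictly below x₀, so the
  -- face of l + ε • m lies inside that of l and consists of maximizers of m there.
  have hev : ∀ᶠ ε : ℝ in nhds 0, ∀ v ∈ V, v ∉ faceOf T l →
      ⟪l + ε • m, v⟫ < ⟪l + ε • m, x₀⟫ := by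
    rw [Filter.eventually_all_finite hV]
    intro v hv
    by_cases h : v ∈ faceOf T l
    · simp [h]
    have hlt : ⟪l, v⟫ < ⟪l, x₀⟫ :=
      lt_of_le_of_ne (hx₀.2 v (hVT hv)) fun h' => h (mem_faceOf_of_inner_eq hx₀ (hVT hv) h')
    have c1 : Continuous fun ε : ℝ => ⟪l + ε • m, v⟫ := by fun_prop
    have c2 : Continuous fun ε : ℝ => ⟪l + ε • m, x₀⟫ := by fun_prop
    filter_upwards [c1.continuousAt.eventually_lt c2.continuousAt (by simpa using hlt)] with ε hε _
    exact hε
  obtain ⟨δ, hδ, hball⟩ := Metric.eventually_nhds_iff.1 hev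
  set ε := δ / 2 with hεd
  have hε : 0 < ε := by positivity
  have hlt := hball (y := ε) (by rw [Real.dist_eq, sub_zero, abs_of_pos hε]; linarith)
  have hle : ∀ v ∈ V, ⟪l + ε • m, v⟫ ≤ ⟪l + ε • m, x₀⟫ := by
    intro v hv
    by_cases h : v ∈ faceOf T l
    · simp only [inner_add_left, real_inner_smul_left]
      rw [inner_eq_of_mem_faceOf h hx₀]
      nlinarith [hmax v h]
    · exact (hlt v hv h).le
  have hx₀' : x₀ ∈ faceOf T (l + ε • m) :=
    ⟨hx₀.1, fun y hy => inner_le_of_mem_convexHull hle (hTV ▸ hy)⟩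
  have hsub : faceOf T (l + ε • m) ⊆ faceOf T l := by
    have h1 := convexHull_inter_faceOf V (l + ε • m)
    rw [← hTV] at h1
    rw [← h1]
    refine convexHull_min ?_ ((isExposed_faceOf T l).convex hT.convex)
    rintro v ⟨hv, hvf⟩
    by_contra h
    exact (hlt v hv h).ne (inner_eq_of_mem_faceOf hvf hx₀')
  refine ⟨_, ⟨isExposed_faceOf T _, ⟨x₀, hx₀'⟩, fun h => hF.2.2 ?_⟩, hsub, ⟪m, x₀⟫, ?_, hmax⟩
  · exact Set.Subset.antisymm (fun x hx => hx.1) (h.symm.trans_subset hsub)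
  · intro y hy
    have h1 := inner_eq_of_mem_faceOf hy hx₀'
    simp only [inner_add_left, real_inner_smul_left] at h1
    rw [inner_eq_of_mem_faceOf (hsub hy) hx₀] at h1
    nlinarith

/-! ### Flags and the action of the symmetry group -/

lemma exists_isFlag {T A F : Set E} (hA : IsProperFace T A) (hF : IsProperFace T F)
    (hAF : A ⊆ F) : ∃ Φ, IsFlag T Φ ∧ A ∈ Φ ∧ F ∈ Φ := by
  obtain ⟨Φ, hsub, hmax⟩ := zorn_subset_nonempty
    {C : Set (Set E) | IsChain (· ⊆ ·) C ∧ ∀ F ∈ C, IsProperFace T F} (by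
      intro c hc hchain _
      refine ⟨⋃₀ c, ⟨?_, ?_⟩, fun s hs => Set.subset_sUnion_of_mem hs⟩
      · rintro a ⟨s, hs, has⟩ b ⟨t, ht, hbt⟩ hab
        rcases hchain.total hs ht with h | h
        · exact (hc ht).1 (h has) hbt hab
        · exact (hc hs).1 has (h hbt) hab
      · rintro a ⟨s, hs, has⟩
        exact (hc hs).2 a has) {A, F} (by
      refine ⟨?_, ?_⟩
      · rintro a (rfl | rfl) b (rfl | rfl) hab
        · exact absurd rfl hab
        · exact Or.inl hAF
        · exact Or.inr hAF
        · exact absurd rfl hab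
      · rintro a (rfl | rfl)
        · exact hA
        · exact hF)
  exact ⟨Φ, hmax, hsub (by simp), hsub (by simp)⟩

/-- The symmetry group acts transitively on the pairs of a minimal and a maximal proper face. -/
lemma IsRegularPolytope.exists_symmetry {T A B F F' : Set E} (hT : IsRegularPolytope T)
    (hF : Maximal (IsProperFace T) F) (hF' : Maximal (IsProperFace T) F')
    (hA : Minimal (IsProperFace T) A) (hB : Minimal (IsProperFace T) B)
    (hAF : A ⊆ F) (hBF : B ⊆ F') :
    ∃ g ∈ symmetryGroup T, g '' F = F' ∧ g '' A = B := by
  obtain ⟨Φ, hΦ, hAΦ, hFΦ⟩ := exists_isFlag hA.1 hF.1 hAF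
  obtain ⟨Ψ, hΨ, hBΨ, hFΨ⟩ := exists_isFlag hB.1 hF'.1 hBF
  obtain ⟨g, hg, rfl⟩ := hT.2 Φ Ψ hΦ hΨ
  -- A maximal face in a flag is its greatest element and a minimal one its least, so a symmetry
  -- between flags matches tops with tops and bottoms with bottoms.
  have hge : ∀ X ∈ Φ, X ⊆ F := fun X hX =>
    (hΦ.1.1.total hX hFΦ).elim id fun h => hF.2 (hΦ.1.2 X hX) h
  have hle : ∀ X ∈ Φ, A ⊆ X := fun X hX =>
    (hΦ.1.1.total hAΦ hX).elim id fun h => hA.2 (hΦ.1.2 X hX) h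
  refine ⟨g, hg, ?_, ?_⟩
  · obtain ⟨X, hX, rfl⟩ := hFΨ
    have hgF := hΨ.1.2 (g '' F) ⟨F, hFΦ, rfl⟩
    have h1 : g '' X ⊆ g '' F := Set.image_mono (hge X hX)
    exact (hF'.2 hgF h1).antisymm h1
  · obtain ⟨X, hX, rfl⟩ := hBΨ
    have hgA := hΨ.1.2 (g '' A) ⟨A, hAΦ, rfl⟩
    have h1 : g '' A ⊆ g '' X := Set.image_mono (hle X hX)
    exact h1.antisymm (hB.2 hgA h1)

lemma IsPolytope.exists_minimal_subset [CompleteSpace E] {T F : Set E} (hT : IsPolytope T)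
    (hF : IsProperFace T F) : ∃ A, Minimal (IsProperFace T) A ∧ A ⊆ F := by
  obtain ⟨A, hAF, hA⟩ := hT.finite_properFaces.exists_le_minimal hF
  exact ⟨A, hA, hAF⟩

lemma IsPolytope.exists_maximal_superset [CompleteSpace E] {T F : Set E} (hT : IsPolytope T)
    (hF : IsProperFace T F) : ∃ G, Maximal (IsProperFace T) G ∧ F ⊆ G := by
  obtain ⟨A, hAF, hA⟩ := hT.finite_properFaces.exists_le_maximal hF
  exact ⟨A, hA, hAF⟩

lemma image_faceOf_of_mem_symmetryGroup {T : Set E} {g : E ≃ₗᵢ[ℝ] E} (hg : g ∈ symmetryGroup T)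
    (u : E) : g '' faceOf T u = faceOf T (g u) := by
  have hg' : g '' T = T := hg
  ext x
  constructor
  · rintro ⟨y, hy, rfl⟩
    refine ⟨hg' ▸ Set.mem_image_of_mem g hy.1, fun z hz => ?_⟩
    rw [← hg'] at hz
    obtain ⟨z, hz, rfl⟩ := hz
    simpa using hy.2 z hz
  · rintro ⟨hx, hmax⟩
    rw [← hg'] at hx
    obtain ⟨y, hy, rfl⟩ := hx
    refine ⟨y, ⟨hy, fun z hz => ?_⟩, rfl⟩
    simpa using hmax (g z) (hg' ▸ Set.mem_image_of_mem g hz)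

/-- A vector fixed by the stabilizer of a maximal proper face is constant on that face. -/
lemma IsRegularPolytope.inner_const_of_fixed [CompleteSpace E] {T : Set E}
    (hT : IsRegularPolytope T) {l m : E} (hF : Maximal (IsProperFace T) (faceOf T l))
    (hfix : ∀ g ∈ symmetryGroup T, g '' faceOf T l = faceOf T l → g m = m) :
    ∃ b : ℝ, ∀ x ∈ faceOf T l, ⟪m, x⟫ = b := by
  obtain ⟨F₁, hF₁, hsub₁, b₁, heq₁, hle₁⟩ := hT.1.exists_subface_max hF.1 m
  obtain ⟨F₂, hF₂, hsub₂, b₂, heq₂, hle₂⟩ := hT.1.exists_subface_max hF.1 (-m)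
  obtain ⟨A, hA, hAF⟩ := hT.1.exists_minimal_subset hF₁
  obtain ⟨B, hB, hBF⟩ := hT.1.exists_minimal_subset hF₂
  -- A lies where m is largest on the face, B where it is smallest. As g stabilizes the face, it
  -- fixes m, so the two extreme values agree.
  obtain ⟨g, hg, hgF, hgA⟩ := hT.exists_symmetry hF hF hA hB
    (hAF.trans hsub₁) (hBF.trans hsub₂)
  obtain ⟨a, ha⟩ := hA.1.2.1
  have h1 : ⟪-m, g a⟫ = b₂ := heq₂ _ (hBF (hgA ▸ Set.mem_image_of_mem g ha))
  have h2 : ⟪m, a⟫ = b₁ := heq₁ _ (hAF ha)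
  have h3 : ⟪m, g a⟫ = ⟪m, a⟫ := by
    conv_lhs => rw [← hfix g hg hgF]
    exact g.inner_map_map m a
  refine ⟨b₁, fun x hx => le_antisymm (hle₁ x hx) ?_⟩
  have := hle₂ x hx
  rw [inner_neg_left] at this h1
  linarith

/-- Both l and g l are normal to the same facet and have equal length, so g l = ±l. The minus sign
would make l both maximal and minimal over T on that facet, which would then be all of T. -/
lemma IsPolytope.map_normal_eq {T : Set E} (hT : IsPolytope T) {l : E}
    (hF : Maximal (IsProperFace T) (faceOf T l)) {g : E ≃ₗᵢ[ℝ] E} (hg : g ∈ symmetryGroup T)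
    (hgF : g '' faceOf T l = faceOf T l) : g l = l := by
  rw [image_faceOf_of_mem_symmetryGroup hg] at hgF
  obtain ⟨x₀, hx₀⟩ := hF.1.2.1
  have hl : l ≠ 0 := by
    rintro rfl
    exact hF.1.2.2 (by simp [faceOf])
  obtain ⟨c, hc⟩ := hT.eq_smul_of_inner_const hF (m := g l) (b := ⟪g l, x₀⟫) (fun x hx => by
    rw [← hgF] at hx hx₀
    exact inner_eq_of_mem_faceOf hx hx₀)
  have hnorm : |c| = 1 := by
    have := congrArg norm hc
    rw [g.norm_map, norm_smul, Real.norm_eq_abs] at this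
    have hpos : 0 < ‖l‖ := norm_pos_iff.2 hl
    field_simp at this
    exact this.symm
  rcases (abs_eq zero_le_one).1 hnorm with rfl | rfl
  · simpa using hc
  · exfalso
    refine hF.1.2.2 (Set.Subset.antisymm (fun x hx => hx.1) fun y hy => ?_)
    refine mem_faceOf_of_inner_eq hx₀ hy (le_antisymm (hx₀.2 y hy) ?_)
    rw [← hgF] at hx₀
    have := hx₀.2 y hy
    rw [hc, neg_smul, one_smul, inner_neg_left, inner_neg_left] at this
    linarith

/-- The normals of the maximal proper faces span the space. -/
lemma IsPolytope.eq_zero_of_inner_normals [FiniteDimensional ℝ E] {T : Set E}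
    (hT : IsPolytope T) {y : E}
    (h : ∀ u, Maximal (IsProperFace T) (faceOf T u) → ⟪u, y⟫ = 0) : y = 0 := by
  by_contra hy
  obtain ⟨p, hp⟩ := hT.2
  have hcl : IsClosed {x | x - p ∈ (ℝ ∙ y)} :=
    (Submodule.closed_of_finiteDimensional (ℝ ∙ y)).preimage (by fun_prop)
  -- q is the point where the line through the interior point p in direction y leaves T. A facet
  -- through q has its normal orthogonal to y, so it would contain p as well, which is impossible.
  obtain ⟨q, ⟨hqT, hq⟩, hmax⟩ := (hT.isCompact.inter_right hcl).exists_isMaxOn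
    ⟨p, interior_subset hp, by simp⟩ (f := fun x => ⟪y, x⟫) (by fun_prop)
  have hqint : q ∉ interior T := by
    intro hqi
    have hc : Filter.Tendsto (fun t : ℝ => q + t • y) (nhds 0) (nhds q) := by
      have : Continuous (fun t : ℝ => q + t • y) := by fun_prop
      simpa using this.tendsto 0
    obtain ⟨ε, hε, hball⟩ := Metric.eventually_nhds_iff.1
      (hc.eventually (mem_interior_iff_mem_nhds.1 hqi))
    have h1 := hball (y := ε / 2) (by rw [Real.dist_eq, sub_zero, abs_of_pos (half_pos hε)]; linarith)
    have h2 : ⟪y, q + (ε / 2) • y⟫ ≤ ⟪y, q⟫ := hmax ⟨h1, by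
      have : q + (ε / 2) • y - p = (q - p) + (ε / 2) • y := by abel
      simp only [Set.mem_ofPred_eq, this]
      exact Submodule.add_mem _ hq (Submodule.smul_mem _ _ (Submodule.mem_span_singleton_self y))⟩
    rw [inner_add_right, inner_smul_right, real_inner_self_eq_norm_sq] at h2
    have : 0 < ‖y‖ ^ 2 := by positivity
    nlinarith
  obtain ⟨f, hf⟩ := geometric_hahn_banach_open_point hT.convex.interior isOpen_interior hqint
  set u := (InnerProductSpace.toDual ℝ E).symm f with hu
  have hfu : ∀ x, ⟪u, x⟫ = f x := fun x => by simp [hu]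
  have hu0 : u ≠ 0 := by
    intro h0
    have := hf p hp
    rw [← hfu, ← hfu, h0] at this
    simp at this
  have hqface : q ∈ faceOf T u := by
    refine ⟨hqT, fun z hz => ?_⟩
    have hz' : z ∈ closure (interior T) := by
      rw [hT.convex.closure_interior_eq_closure_of_nonempty_interior ⟨p, hp⟩]
      exact subset_closure hz
    have hcl : IsClosed {z | ⟪u, z⟫ ≤ ⟪u, q⟫} := isClosed_le (by fun_prop) (by fun_prop)
    refine closure_minimal (fun z hz => ?_) hcl hz'
    simp only [Set.mem_ofPred_eq, hfu]
    exact (hf z hz).le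
  obtain ⟨G, hG, hsub⟩ := hT.exists_maximal_superset (hT.isProperFace_faceOf hu0)
  obtain ⟨w, rfl⟩ := hG.1.exists_normal
  obtain ⟨t, ht⟩ := Submodule.mem_span_singleton.1 hq
  have hpq : ⟪w, p⟫ = ⟪w, q⟫ := by
    have : q = p + t • y := by rw [ht]; abel
    rw [this, inner_add_right, inner_smul_right, h w hG]
    simp
  have hpG := mem_faceOf_of_inner_eq (hsub hqface) (interior_subset hp) hpq
  have := eq_zero_of_mem_interior_of_max hp hpG.2
  subst this
  exact hG.1.2.2 (by simp [faceOf])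

/-- A symmetric operator that commutes with the symmetries of a regular polytope is scalar. -/
theorem IsRegularPolytope.exists_eq_smul_of_commute [FiniteDimensional ℝ E] [Nontrivial E]
    {T : Set E} (hT : IsRegularPolytope T) {M : E →ₗ[ℝ] E} (hM : M.IsSymmetric)
    (hcomm : ∀ g ∈ symmetryGroup T, ∀ x, M (g x) = g (M x)) :
    ∃ c : ℝ, ∀ x, M x = c • x := by
  obtain ⟨v, hv⟩ := exists_ne (0 : E)
  obtain ⟨F, hF, -⟩ := hT.1.exists_maximal_superset (hT.1.isProperFace_faceOf hv)
  obtain ⟨u, rfl⟩ := hF.1.exists_normal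
  obtain ⟨b, hb⟩ := hT.inner_const_of_fixed (m := M u) hF (fun g hg hgF => by
    rw [← hcomm g hg, hT.1.map_normal_eq hF hg hgF])
  obtain ⟨c, hc⟩ := hT.1.eq_smul_of_inner_const hF hb
  refine ⟨c, fun x => ?_⟩
  rw [← sub_eq_zero]
  -- By symmetry of M it is enough that M w = c • w for each facet normal w. Such a w is a multiple
  -- of some g u, and M commutes with g.
  refine hT.1.eq_zero_of_inner_normals fun w hw => ?_
  obtain ⟨A, hA, hAF⟩ := hT.1.exists_minimal_subset hF.1
  obtain ⟨B, hB, hBF⟩ := hT.1.exists_minimal_subset hw.1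
  obtain ⟨g, hg, hgF, -⟩ := hT.exists_symmetry hF hw hA hB hAF hBF
  rw [image_faceOf_of_mem_symmetryGroup hg] at hgF
  obtain ⟨x₀, hx₀⟩ := hw.1.2.1
  obtain ⟨d, hd⟩ := hT.1.eq_smul_of_inner_const (m := w) (b := ⟪w, x₀⟫) (hgF ▸ hw)
    (fun x hx => inner_eq_of_mem_faceOf (hgF ▸ hx) hx₀)
  have hMw : M w = c • w := by
    rw [hd, map_smul, hcomm g hg, hc, map_smul, smul_comm]
  rw [inner_sub_right, ← hM w x, hMw, real_inner_smul_left, inner_smul_right, sub_self]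

/-- The symmetry group of a regular polytope has no nonzero fixed vector. -/
theorem IsRegularPolytope.eq_zero_of_fixed [FiniteDimensional ℝ E]
    (hdim : 2 ≤ Module.finrank ℝ E) {T : Set E} (hT : IsRegularPolytope T) {z : E}
    (hz : ∀ g ∈ symmetryGroup T, g z = z) : z = 0 := by
  have : Nontrivial E := Module.nontrivial_of_finrank_pos (R := ℝ) (by omega)
  obtain ⟨c, hc⟩ := hT.exists_eq_smul_of_commute (M := (innerₛₗ ℝ z).smulRight z)
    (fun x y => by
      simp [inner_smul_right, real_inner_comm]
      ring)
    (fun g hg x => by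
      have : ⟪z, g x⟫ = ⟪z, x⟫ := by
        conv_lhs => rw [← hz g hg]
        exact g.inner_map_map z x
      simp [this, hz g hg])
  by_contra hz0
  -- In dimension at least 2 some y ≠ 0 is orthogonal to z. It is killed by the rank-one operator,
  -- so the scalar is 0, whereas z itself is not killed.
  obtain ⟨y, hy0, hy⟩ : ∃ y : E, y ≠ 0 ∧ ⟪z, y⟫ = 0 := by
    have h1 := Submodule.finrank_add_finrank_orthogonal (ℝ ∙ z)
    rw [finrank_span_singleton hz0] at h1
    have : Nontrivial (ℝ ∙ z)ᗮ := Module.nontrivial_of_finrank_pos (R := ℝ) (by omega)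
    obtain ⟨y, hy⟩ := exists_ne (0 : (ℝ ∙ z)ᗮ)
    exact ⟨y, by simpa using hy, Submodule.mem_orthogonal_singleton_iff_inner_right.1 y.2⟩
  have h1 := hc y
  have h2 := hc z
  simp [hy] at h1 h2
  rw [(smul_eq_zero.1 h1.symm).resolve_right hy0] at h2
  simp [hz0] at h2

end PolytopeFaces

/-! ### Finiteness and invariance of the surface measure -/

section SphereMeasure

variable {E : Type*} [NormedAddCommGroup E] [InnerProductSpace ℝ E]

/-- In this normalization of stereographic projection from v, the point over w has v-component (‖w‖²
- 4) / (‖w‖² + 4), which is nonpositive exactly when ‖w‖ ≤ 2. -/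
lemma hemisphere_subset_image_stereoInvFunAux {v : E} (hv : ‖v‖ = 1) :
    {x ∈ sphere (0 : E) 1 | ⟪v, x⟫ ≤ 0} ⊆
      (fun w : (ℝ ∙ v)ᗮ => stereoInvFunAux v (w : E)) '' closedBall 0 2 := by
  rintro x ⟨hx, hvx⟩
  have hne : x ≠ v := by
    rintro rfl
    rw [real_inner_self_eq_norm_sq, hv] at hvx
    norm_num at hvx
  have hinv := congrArg Subtype.val (stereo_left_inv hv (x := ⟨x, hx⟩) hne)
  set w := stereoToFun v x with hw
  refine ⟨w, ?_, hinv⟩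
  have hwv : ⟪v, (w : E)⟫ = 0 := Submodule.mem_orthogonal_singleton_iff_inner_right.1 w.2
  have hx' : x = (‖w‖ ^ 2 + 4)⁻¹ • ((4 : ℝ) • (w : E) + (‖w‖ ^ 2 - 4) • v) := hinv.symm
  rw [hx', inner_smul_right, inner_add_right, inner_smul_right, inner_smul_right, hwv,
    real_inner_self_eq_norm_sq, hv] at hvx
  have hpos : 0 < (‖w‖ ^ 2 + 4)⁻¹ := by positivity
  have : ‖w‖ ^ 2 ≤ 4 := by
    by_contra! h
    nlinarith [mul_pos hpos (sub_pos.2 h)]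
  rw [mem_closedBall_zero_iff]
  nlinarith [norm_nonneg w]

variable [FiniteDimensional ℝ E] [MeasurableSpace E] [BorelSpace E]

/-- A C¹ map is Lipschitz on a compact convex ball, and in the n-dimensional space v^⊥ the measure
μH[n] is a Haar measure, so the ball has finite measure. -/
lemma hausdorffMeasure_hemisphere_lt_top {n : ℕ} (hn : Module.finrank ℝ E = n + 1) {v : E}
    (hv : ‖v‖ = 1) : μH[n] {x ∈ sphere (0 : E) 1 | ⟪v, x⟫ ≤ 0} < ⊤ := by
  have hdim : Module.finrank ℝ (ℝ ∙ v)ᗮ = n := by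
    have : Fact (Module.finrank ℝ E = n + 1) := ⟨hn⟩
    exact Submodule.finrank_orthogonal_span_singleton (norm_ne_zero_iff.1 (by rw [hv]; simp))
  have hC : ContDiff ℝ 1 (fun w : (ℝ ∙ v)ᗮ => stereoInvFunAux v (w : E)) :=
    contDiff_stereoInvFunAux.comp (ℝ ∙ v)ᗮ.subtypeL.contDiff
  obtain ⟨L, hL⟩ := hC.contDiffOn.exists_lipschitzOnWith one_ne_zero
    (convex_closedBall (0 : (ℝ ∙ v)ᗮ) 2) (isCompact_closedBall _ _)
  refine (measure_mono (hemisphere_subset_image_stereoInvFunAux hv)).trans_lt ?_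
  refine (hL.hausdorffMeasure_image_le n.cast_nonneg).trans_lt ?_
  refine ENNReal.mul_lt_top (by simp [ENNReal.rpow_natCast]) ?_
  have : (μH[n] : Measure (ℝ ∙ v)ᗮ).IsAddHaarMeasure := by
    rw [← hdim]
    exact isAddHaarMeasure_hausdorffMeasure
  exact (isCompact_closedBall _ _).measure_lt_top

lemma hausdorffMeasure_sphere_lt_top {n : ℕ} (hn : Module.finrank ℝ E = n + 1) :
    μH[n] (sphere (0 : E) 1) < ⊤ := by
  have : Nontrivial E := Module.nontrivial_of_finrank_pos (R := ℝ) (by omega)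
  obtain ⟨v, hv⟩ := exists_norm_eq E zero_le_one
  refine (measure_mono (t := {x ∈ sphere (0 : E) 1 | ⟪v, x⟫ ≤ 0} ∪
    {x ∈ sphere (0 : E) 1 | ⟪-v, x⟫ ≤ 0}) fun x hx => ?_).trans_lt
    ((measure_union_le _ _).trans_lt (ENNReal.add_lt_top.2
      ⟨hausdorffMeasure_hemisphere_lt_top hn hv,
        hausdorffMeasure_hemisphere_lt_top hn (by rwa [norm_neg])⟩))
  rcases le_total ⟪v, x⟫ 0 with h | h
  · exact Or.inl ⟨hx, h⟩
  · exact Or.inr ⟨hx, by rw [inner_neg_left]; linarith⟩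

instance (n : ℕ) : IsFiniteMeasure (sphereMeasure n) := by
  refine ⟨?_⟩
  rw [sphereMeasure, Measure.restrict_apply_univ, Measure.euclideanHausdorffMeasure_def,
    Measure.smul_apply]
  exact ENNReal.mul_lt_top ENNReal.coe_lt_top (hausdorffMeasure_sphere_lt_top (by simp))

lemma measurePreserving_sphereMeasure {n : ℕ}
    (g : EuclideanSpace ℝ (Fin (n + 1)) ≃ₗᵢ[ℝ] EuclideanSpace ℝ (Fin (n + 1))) :
    MeasurePreserving g (sphereMeasure n) (sphereMeasure n) := by
  have h := (g.toIsometryEquiv.measurePreserving_euclideanHausdorffMeasure n).restrict_preimage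
    (s := sphere 0 1) isClosed_sphere.measurableSet
  have hpre : g.toIsometryEquiv ⁻¹' sphere 0 1 = sphere 0 1 := by
    ext x
    simp
  rw [hpre] at h
  exact h

end SphereMeasure

/-! ### Invariance and boundedness of the Hessian determinant -/

section Hessian

/-- The determinant of the Gram matrix of a bilinear form does not depend on the orthonormal basis
and is invariant under linear isometries. -/
lemma det_bilin_orthonormalBasis_eq {V W ι κ : Type*} [NormedAddCommGroup V]
    [InnerProductSpace ℝ V] [NormedAddCommGroup W] [InnerProductSpace ℝ W]
    [Fintype ι] [DecidableEq ι] [Fintype κ] [DecidableEq κ]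
    (e : OrthonormalBasis ι ℝ V) (e' : OrthonormalBasis κ ℝ W) (φ : V ≃ₗᵢ[ℝ] W)
    (B : LinearMap.BilinForm ℝ V) (B' : LinearMap.BilinForm ℝ W)
    (h : ∀ u v, B' (φ u) (φ v) = B u v) :
    (Matrix.of fun i j => B (e i) (e j)).det = (Matrix.of fun i j => B' (e' i) (e' j)).det := by
  let b := e.map φ
  have hcard : κ ≃ ι := e'.toBasis.indexEquiv b.toBasis
  let c := e'.reindex hcard
  have h1 : (Matrix.of fun i j => B' (e' i) (e' j)).det =
      (LinearMap.BilinForm.toMatrix c.toBasis B').det := by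
    rw [← Matrix.det_submatrix_equiv_self hcard.symm]
    congr 1
    ext i j
    simp [c, LinearMap.BilinForm.toMatrix_apply]
  have h2 : (Matrix.of fun i j => B (e i) (e j)) = LinearMap.BilinForm.toMatrix b.toBasis B' := by
    ext i j
    simp [b, LinearMap.BilinForm.toMatrix_apply, h]
  rw [h1, h2, ← LinearMap.BilinForm.toMatrix_mul_basis_toMatrix c.toBasis b.toBasis B',
    Matrix.det_mul, Matrix.det_mul, Matrix.det_transpose]
  -- The change of basis between orthonormal bases has determinant ±1, and it enters the determinant
  -- of the form squared.
  have h3 : (c.toBasis.toMatrix b.toBasis).det * (c.toBasis.toMatrix b.toBasis).det = 1 := by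
    rcases c.det_to_matrix_orthonormalBasis_real b with h | h <;>
    · have : (c.toBasis.toMatrix b.toBasis).det = _ := h
      rw [this]
      norm_num
  rw [mul_right_comm, h3, one_mul]

variable {E : Type*} [NormedAddCommGroup E] [InnerProductSpace ℝ E]

lemma radialExtension_map {f : E → ℝ} {g : E ≃ₗᵢ[ℝ] E}
    (hg : ∀ x ∈ sphere (0 : E) 1, f (g x) = f x) (y : E) :
    radialExtension f (g y) = radialExtension f y := by
  rcases eq_or_ne y 0 with rfl | hy
  · simp
  · rw [radialExtension, radialExtension, g.norm_map, ← map_smul]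
    exact hg _ (by simp [norm_smul, hy])

/-- The radial extension is invariant under g; differentiate this twice. The first-order identity
holds at every point, the origin included, since g is a linear equivalence; the second needs x ≠ 0,
where the extension is C². -/
lemma sphereHessian_map {f : E → ℝ} (hf : IsC2OnSphere f) {g : E ≃ₗᵢ[ℝ] E}
    (hg : ∀ x ∈ sphere (0 : E) 1, f (g x) = f x) {x : E} (hx : x ≠ 0) (u v : E) :
    sphereHessian f (g x) (g u) (g v) = sphereHessian f x u v := by
  have hfd : ∀ y, fderiv ℝ (radialExtension f) y =
      (fderiv ℝ (radialExtension f) (g y)).comp (g : E →L[ℝ] E) := by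
    intro y
    have h := g.toContinuousLinearEquiv.comp_right_fderiv (f := radialExtension f) (x := y)
    have hcomp : radialExtension f ∘ g.toContinuousLinearEquiv = radialExtension f :=
      funext fun y => radialExtension_map hg y
    rw [hcomp] at h
    exact h
  have hdiff : DifferentiableAt ℝ (fderiv ℝ (radialExtension f)) (g x) := by
    have hgx : g x ≠ 0 := by simpa using hx
    have h1 : ContDiffOn ℝ 1 (fderiv ℝ (radialExtension f)) {0}ᶜ :=
      hf.fderiv_of_isOpen isOpen_compl_singleton (by norm_num)
    exact (h1.differentiableOn one_ne_zero).differentiableAt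
      (isOpen_compl_singleton.mem_nhds hgx)
  have h2 : HasFDerivAt (fun y => (fderiv ℝ (radialExtension f) (g y)).comp (g : E →L[ℝ] E))
      ((((ContinuousLinearMap.compL ℝ E E ℝ).flip (g : E →L[ℝ] E)).comp
        (fderiv ℝ (fderiv ℝ (radialExtension f)) (g x))).comp (g : E →L[ℝ] E)) x :=
    (((ContinuousLinearMap.compL ℝ E E ℝ).flip (g : E →L[ℝ] E)).hasFDerivAt.comp (g x)
      hdiff.hasFDerivAt).comp x (g : E →L[ℝ] E).hasFDerivAt
  have h3 := h2.fderiv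
  rw [← funext hfd] at h3
  simp only [sphereHessian]
  rw [h3]
  rfl

lemma IsC2OnSphere.continuousOn {f : E → ℝ} (hf : IsC2OnSphere f) :
    ContinuousOn f (sphere (0 : E) 1) := by
  have h : ContinuousOn (radialExtension f) (sphere (0 : E) 1) :=
    (ContDiffOn.continuousOn hf).mono fun x hx => ne_zero_of_mem_unit_sphere ⟨x, hx⟩
  refine h.congr fun x hx => ?_
  rw [radialExtension, mem_sphere_zero_iff_norm.1 hx]
  simp

variable [FiniteDimensional ℝ E]

/-- The bilinear form `∇²f + f I` on the tangent space of the sphere at `x`. -/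
noncomputable def shiftedHessian (f : E → ℝ) (x : E) : LinearMap.BilinForm ℝ (ℝ ∙ x)ᗮ :=
  LinearMap.mk₂ ℝ (fun u v => sphereHessian f x u v + f x * ⟪(u : E), (v : E)⟫)
    (by intros; simp [sphereHessian, inner_add_left]; ring)
    (by intros; simp [sphereHessian, real_inner_smul_left]; ring)
    (by intros; simp [sphereHessian, inner_add_right]; ring)
    (by intros; simp [sphereHessian, inner_smul_right]; ring)

lemma detHessian_eq (f : E → ℝ) (x : E) :
    detHessian f x = (Matrix.of fun i j => shiftedHessian f x
      (stdOrthonormalBasis ℝ (ℝ ∙ x)ᗮ i) (stdOrthonormalBasis ℝ (ℝ ∙ x)ᗮ j)).det := by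
  rw [detHessian]
  congr 1
  ext i j
  have := orthonormal_iff_ite.1 (stdOrthonormalBasis ℝ (ℝ ∙ x)ᗮ).orthonormal i j
  rw [Submodule.coe_inner] at this
  simp only [Matrix.of_apply, shiftedHessian, LinearMap.mk₂_apply, this]

/-- The orthonormal bases chosen at x and at g x are unrelated, so independence of the basis is
needed besides invariance of the form. -/
lemma detHessian_map {f : E → ℝ} (hf : IsC2OnSphere f) {g : E ≃ₗᵢ[ℝ] E}
    (hg : ∀ x ∈ sphere (0 : E) 1, f (g x) = f x) {x : E} (hx : x ∈ sphere (0 : E) 1) :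
    detHessian f (g x) = detHessian f x := by
  have hmap : (ℝ ∙ x)ᗮ.map (g.toLinearEquiv : E →ₗ[ℝ] E) = (ℝ ∙ g x)ᗮ := by
    rw [Submodule.map_orthogonal_equiv, Submodule.map_span]
    simp
  let φ : (ℝ ∙ x)ᗮ ≃ₗᵢ[ℝ] (ℝ ∙ g x)ᗮ :=
    (g.submoduleMap _).trans (LinearIsometryEquiv.ofEq _ _ hmap)
  rw [detHessian_eq, detHessian_eq]
  refine (det_bilin_orthonormalBasis_eq _ _ φ _ _ fun u v => ?_).symm
  have hφ : ∀ u, ((φ u : (ℝ ∙ g x)ᗮ) : E) = g u := fun u => rfl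
  have hx0 : x ≠ 0 := ne_zero_of_mem_unit_sphere ⟨x, hx⟩
  simp only [shiftedHessian, LinearMap.mk₂_apply, hφ, g.inner_map_map, hg x hx,
    sphereHessian_map hf hg hx0]

/-- The chosen basis of x^⊥ need not vary continuously with x, so the matrix entries are bounded
uniformly by compactness instead. -/
lemma exists_abs_detHessian_le {f : E → ℝ} (hf : IsC2OnSphere f) :
    ∃ C : ℝ, ∀ x ∈ sphere (0 : E) 1, |detHessian f x| ≤ C := by
  have h1 : ContDiffOn ℝ 1 (fderiv ℝ (radialExtension f)) {0}ᶜ :=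
    ContDiffOn.fderiv_of_isOpen hf isOpen_compl_singleton (by norm_num)
  have h2 : ContinuousOn (fderiv ℝ (fderiv ℝ (radialExtension f))) {0}ᶜ :=
    h1.continuousOn_fderiv_of_isOpen isOpen_compl_singleton le_rfl
  have hsub : sphere (0 : E) 1 ⊆ {0}ᶜ := fun x hx => ne_zero_of_mem_unit_sphere ⟨x, hx⟩
  obtain ⟨A, hA⟩ := (isCompact_sphere (0 : E) 1).exists_bound_of_continuousOn
    ((continuous_norm (E := E →L[ℝ] E →L[ℝ] ℝ)).comp_continuousOn (h2.mono hsub))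
  simp only [Function.comp_apply, norm_norm] at hA
  obtain ⟨D, hD⟩ := (isCompact_sphere (0 : E) 1).exists_bound_of_continuousOn hf.continuousOn
  set N := Module.finrank ℝ E - 1
  -- The Leibniz expansion has N! terms, each a product of N entries bounded by A + D, with N the
  -- dimension of x^⊥.
  refine ⟨N.factorial • (A + D) ^ N, fun x hx => ?_⟩
  have hdim : Module.finrank ℝ (ℝ ∙ x)ᗮ = N := by
    have h3 := Submodule.finrank_add_finrank_orthogonal (ℝ ∙ x)
    rw [finrank_span_singleton (hsub hx)] at h3
    omega
  rw [detHessian_eq, ← hdim]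
  have hb := Matrix.det_le (abv := AbsoluteValue.abs) (x := A + D)
    (A := Matrix.of fun i j => shiftedHessian f x
      (stdOrthonormalBasis ℝ (ℝ ∙ x)ᗮ i) (stdOrthonormalBasis ℝ (ℝ ∙ x)ᗮ j)) ?_
  · simpa using hb
  intro i j
  set e := stdOrthonormalBasis ℝ (ℝ ∙ x)ᗮ
  have hn : ∀ i, ‖(e i : E)‖ = 1 := fun i => e.orthonormal.1 i
  simp only [Matrix.of_apply, shiftedHessian, LinearMap.mk₂_apply, AbsoluteValue.abs_apply]
  refine (abs_add_le _ _).trans (add_le_add ?_ ?_)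
  · have := (fderiv ℝ (fderiv ℝ (radialExtension f)) x).le_opNorm₂ (e i) (e j)
    rw [hn, hn, mul_one, mul_one, Real.norm_eq_abs] at this
    exact this.trans (hA x hx)
  · rw [abs_mul]
    have h4 := abs_real_inner_le_norm (e i : E) (e j)
    rw [hn, hn, mul_one] at h4
    exact (mul_le_of_le_one_right (abs_nonneg _) h4).trans (hD x hx)

end Hessian

/-! ### Support functions and the position of the origin -/

section ConvexBodies

variable {n : ℕ} {T : Set (EuclideanSpace ℝ (Fin (n + 1)))}
  {K : ConvexBody (EuclideanSpace ℝ (Fin (n + 1)))}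

lemma bddAbove_supportFn (K : ConvexBody (EuclideanSpace ℝ (Fin (n + 1))))
    (x : EuclideanSpace ℝ (Fin (n + 1))) :
    BddAbove ((fun z => ⟪z, x⟫) '' (K : Set (EuclideanSpace ℝ (Fin (n + 1))))) :=
  (K.isCompact.image (by fun_prop)).bddAbove

lemma inner_le_supportFn {z : EuclideanSpace ℝ (Fin (n + 1))} (hz : z ∈ K)
    (x : EuclideanSpace ℝ (Fin (n + 1))) : ⟪z, x⟫ ≤ supportFn K x :=
  le_csSup (bddAbove_supportFn K x) ⟨z, hz, rfl⟩

lemma supportFn_le {x : EuclideanSpace ℝ (Fin (n + 1))} {c : ℝ}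
    (h : ∀ z ∈ K, ⟪z, x⟫ ≤ c) : supportFn K x ≤ c := by
  refine csSup_le (K.nonempty.image _) ?_
  rintro _ ⟨z, hz, rfl⟩
  exact h z hz

lemma continuous_supportFn (K : ConvexBody (EuclideanSpace ℝ (Fin (n + 1)))) :
    Continuous (supportFn K) := by
  obtain ⟨R, hR⟩ := K.isCompact.isBounded.exists_norm_le
  refine (LipschitzWith.of_le_add_mul R.toNNReal fun x y => supportFn_le fun z hz => ?_).continuous
  have h1 : ⟪z, x⟫ = ⟪z, y⟫ + ⟪z, x - y⟫ := by
    rw [inner_sub_right]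
    ring
  have h2 : ⟪z, x - y⟫ ≤ R.toNNReal * dist x y := by
    rw [dist_eq_norm]
    refine (real_inner_le_norm _ _).trans (mul_le_mul_of_nonneg_right ?_ (norm_nonneg _))
    exact (hR z hz).trans (Real.le_coe_toNNReal R)
  linarith [inner_le_supportFn hz y]

/-- A closed convex nonempty set that is invariant under the symmetries of a regular polytope
contains the origin. -/
lemma IsRegularPolytope.zero_mem_of_invariant {E : Type*} [NormedAddCommGroup E]
    [InnerProductSpace ℝ E] [FiniteDimensional ℝ E] (hdim : 2 ≤ Module.finrank ℝ E)
    {T S : Set E} (hT : IsRegularPolytope T) (hne : S.Nonempty) (hcl : IsClosed S)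
    (hconv : Convex ℝ S) (hS : ∀ g ∈ symmetryGroup T, ∀ z ∈ S, g z ∈ S) : (0 : E) ∈ S := by
  obtain ⟨p, hp, hmin⟩ := hcl.exists_infDist_eq_dist hne (0 : E)
  have hmin : ∀ q ∈ S, ‖p‖ ≤ ‖q‖ := fun q hq => by
    have := infDist_le_dist_of_mem (x := (0 : E)) hq
    rwa [hmin, dist_zero_left, dist_zero_left] at this
  suffices p = 0 from this ▸ hp
  refine hT.eq_zero_of_fixed hdim fun g hg => ?_
  -- The midpoint of p and g p lies in S, hence is no shorter than p; since ‖g p‖ = ‖p‖, the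
  -- parallelogram law gives g p = p.
  have hmid := hmin _ (hconv hp (hS g hg p hp) (a := 1 / 2) (b := 1 / 2) (by norm_num)
    (by norm_num) (by norm_num))
  rw [← smul_add, norm_smul] at hmid
  have hpar := parallelogram_law_with_norm ℝ p (g p)
  rw [g.norm_map] at hpar
  norm_num at hmid
  have h2 : ‖p - g p‖ = 0 := by
    nlinarith [norm_nonneg p, norm_nonneg (p + g p), norm_nonneg (p - g p)]
  exact (sub_eq_zero.1 (norm_eq_zero.1 h2)).symm

lemma exists_pos_le_supportFn (hn : 2 ≤ n) (hT : IsRegularPolytope T)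
    (hK : (interior (K : Set (EuclideanSpace ℝ (Fin (n + 1))))).Nonempty)
    (hsymm : IsStronglySymmetric T K) :
    ∃ r > 0, ∀ x ∈ sphere (0 : EuclideanSpace ℝ (Fin (n + 1))) 1, r ≤ supportFn K x := by
  obtain ⟨z, hz⟩ := hK
  obtain ⟨r, hr, hball⟩ := nhds_basis_closedBall.mem_iff.1 (mem_interior_iff_mem_nhds.1 hz)
  refine ⟨r, hr, ?_⟩
  -- S consists of the centres z of balls of radius r inside K, expressed through the support
  -- function so that invariance of h_K passes to S.
  let S : Set (EuclideanSpace ℝ (Fin (n + 1))) :=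
    ⋂ y ∈ sphere (0 : EuclideanSpace ℝ (Fin (n + 1))) 1, {z | ⟪y, z⟫ ≤ supportFn K y - r}
  have h0 : (0 : EuclideanSpace ℝ (Fin (n + 1))) ∈ S := by
    refine hT.zero_mem_of_invariant (by simp; omega) ⟨z, ?_⟩ ?_ ?_ ?_
    · refine Set.mem_iInter₂.2 fun y hy => ?_
      have hy1 : ‖y‖ = 1 := by simpa using hy
      have := inner_le_supportFn (hball (show z + r • y ∈ closedBall z r by
        simp [norm_smul, hy1, abs_of_pos hr])) y
      rw [inner_add_left, real_inner_smul_left, real_inner_self_eq_norm_sq, hy1,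
        real_inner_comm] at this
      simp only [Set.mem_ofPred_eq]
      linarith
    · exact isClosed_biInter fun y _ => isClosed_le (by fun_prop) (by fun_prop)
    · exact convex_iInter₂ fun y _ =>
        convex_halfSpace_le (innerSL ℝ y).toLinearMap.isLinear (supportFn K y - r)
    · intro g hg z hz
      refine Set.mem_iInter₂.2 fun y hy => ?_
      have hy' : g.symm y ∈ sphere (0 : EuclideanSpace ℝ (Fin (n + 1))) 1 := by
        simpa using hy
      have h1 := Set.mem_iInter₂.1 hz (g.symm y) hy'
      have h2 := hsymm g hg _ hy'
      rw [g.apply_symm_apply] at h2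
      simp only [Set.mem_ofPred_eq] at h1 ⊢
      rw [← g.inner_map_map, g.apply_symm_apply] at h1
      rwa [h2]
  intro x hx
  have := Set.mem_iInter₂.1 h0 x hx
  simp at this
  exact this

/-! ### The cone measure and its invariance -/

lemma ae_coneMeasure_mem_sphere (K : ConvexBody (EuclideanSpace ℝ (Fin (n + 1)))) :
    ∀ᵐ x ∂coneMeasure K, x ∈ sphere (0 : EuclideanSpace ℝ (Fin (n + 1))) 1 :=
  (withDensity_absolutelyContinuous _ _).ae_le (ae_restrict_mem isClosed_sphere.measurableSet)

lemma isFiniteMeasure_coneMeasure (hC2 : IsC2OnSphere (supportFn K)) :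
    IsFiniteMeasure (coneMeasure K) := by
  obtain ⟨C, hC⟩ := exists_abs_detHessian_le hC2
  obtain ⟨D, hD⟩ := (isCompact_sphere (0 : EuclideanSpace ℝ (Fin (n + 1)))
    1).exists_bound_of_continuousOn hC2.continuousOn
  refine ⟨?_⟩
  rw [coneMeasure, withDensity_apply _ MeasurableSet.univ, Measure.restrict_univ]
  refine (lintegral_mono_ae (g := fun _ => ENNReal.ofReal (D * C)) ?_).trans_lt ?_
  · filter_upwards [ae_restrict_mem isClosed_sphere.measurableSet] with x hx
    refine ENNReal.ofReal_le_ofReal ((le_abs_self _).trans ?_)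
    rw [abs_mul]
    exact mul_le_mul (hD x hx) (hC x hx) (abs_nonneg _) ((norm_nonneg _).trans (hD x hx))
  · rw [lintegral_const]
    exact ENNReal.mul_lt_top ENNReal.ofReal_lt_top (measure_lt_top _ _)

lemma measurableEmbedding_linearIsometryEquiv
    (g : EuclideanSpace ℝ (Fin (n + 1)) ≃ₗᵢ[ℝ] EuclideanSpace ℝ (Fin (n + 1))) :
    MeasurableEmbedding g :=
  g.toHomeomorph.measurableEmbedding

/-- Both factors of the density and the surface measure are g-invariant. As g is a measurable
embedding, the change of variables requires no measurability of the density. -/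
lemma measurePreserving_coneMeasure (hC2 : IsC2OnSphere (supportFn K))
    (hsymm : IsStronglySymmetric T K)
    {g : EuclideanSpace ℝ (Fin (n + 1)) ≃ₗᵢ[ℝ] EuclideanSpace ℝ (Fin (n + 1))}
    (hg : g ∈ symmetryGroup T) : MeasurePreserving g (coneMeasure K) (coneMeasure K) := by
  have hgm := (measurableEmbedding_linearIsometryEquiv g).measurable
  refine ⟨hgm, ?_⟩
  ext s hs
  rw [Measure.map_apply hgm hs, coneMeasure, withDensity_apply _ (hgm hs), withDensity_apply _ hs,
    ← (measurePreserving_sphereMeasure g).setLIntegral_comp_preimage_emb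
      (measurableEmbedding_linearIsometryEquiv g) _ s]
  refine lintegral_congr_ae (ae_restrict_of_ae ?_)
  filter_upwards [ae_restrict_mem isClosed_sphere.measurableSet] with x hx
  rw [hsymm g hg x hx, detHessian_map hC2 (hsymm g hg) hx]

lemma integrable_inv_sq_supportFn (hn : 2 ≤ n) (hT : IsRegularPolytope T)
    (hK : (interior (K : Set (EuclideanSpace ℝ (Fin (n + 1))))).Nonempty)
    (hC2 : IsC2OnSphere (supportFn K)) (hsymm : IsStronglySymmetric T K) :
    Integrable (fun x => (supportFn K x ^ 2)⁻¹) (coneMeasure K) := by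
  have := isFiniteMeasure_coneMeasure hC2
  obtain ⟨r, hr, hle⟩ := exists_pos_le_supportFn hn hT hK hsymm
  refine Integrable.of_bound (C := (r ^ 2)⁻¹)
    ((continuous_supportFn K).measurable.pow_const 2).inv.aestronglyMeasurable ?_
  filter_upwards [ae_coneMeasure_mem_sphere K] with x hx
  rw [Real.norm_of_nonneg (by positivity)]
  have := hle x hx
  gcongr

/-! ### The second moment operator -/

lemma integrable_secondMoment
    (hint : Integrable (fun x => (supportFn K x ^ 2)⁻¹) (coneMeasure K))
    (u : EuclideanSpace ℝ (Fin (n + 1))) :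
    Integrable (fun x => ((supportFn K x ^ 2)⁻¹ * ⟪u, x⟫) • x) (coneMeasure K) := by
  refine Integrable.mono' (hint.mul_const ‖u‖) ?_ ?_
  · have h1 : Measurable fun x => (supportFn K x ^ 2)⁻¹ :=
      ((continuous_supportFn K).measurable.pow_const 2).inv
    have h2 : Measurable fun x : EuclideanSpace ℝ (Fin (n + 1)) => ⟪u, x⟫ :=
      (by fun_prop : Continuous fun x : EuclideanSpace ℝ (Fin (n + 1)) => ⟪u, x⟫).measurable
    exact ((h1.mul h2).smul measurable_id).aestronglyMeasurable
  · filter_upwards [ae_coneMeasure_mem_sphere K] with x hx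
    have hx1 : ‖x‖ = 1 := by simpa using hx
    rw [norm_smul, hx1, mul_one, norm_mul, Real.norm_of_nonneg (by positivity)]
    refine mul_le_mul_of_nonneg_left ?_ (by positivity)
    simpa [hx1] using norm_inner_le_norm (𝕜 := ℝ) u x

/-- The second moment operator `u ↦ ∫ h_K⁻² ⟪u, x⟫ x dV_K`. -/
noncomputable def secondMoment (K : ConvexBody (EuclideanSpace ℝ (Fin (n + 1))))
    (hint : Integrable (fun x => (supportFn K x ^ 2)⁻¹) (coneMeasure K)) :
    EuclideanSpace ℝ (Fin (n + 1)) →ₗ[ℝ] EuclideanSpace ℝ (Fin (n + 1)) where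
  toFun u := ∫ x, ((supportFn K x ^ 2)⁻¹ * ⟪u, x⟫) • x ∂coneMeasure K
  map_add' u v := by
    rw [← integral_add (integrable_secondMoment hint u) (integrable_secondMoment hint v)]
    simp only [inner_add_left, mul_add, add_smul]
  map_smul' c u := by
    rw [RingHom.id_apply, ← integral_smul]
    simp only [real_inner_smul_left, smul_smul, mul_left_comm]

lemma inner_secondMoment (hint : Integrable (fun x => (supportFn K x ^ 2)⁻¹) (coneMeasure K))
    (u v : EuclideanSpace ℝ (Fin (n + 1))) :
    ⟪v, secondMoment K hint u⟫ =
      ∫ x, ⟪u, x⟫ * ⟪v, x⟫ / supportFn K x ^ 2 ∂coneMeasure K := by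
  change ⟪v, ∫ x, ((supportFn K x ^ 2)⁻¹ * ⟪u, x⟫) • x ∂coneMeasure K⟫ = _
  rw [← integral_inner (integrable_secondMoment hint u)]
  refine integral_congr_ae (Filter.Eventually.of_forall fun x => ?_)
  simp only [inner_smul_right]
  ring

/-- Substitute x ↦ g x in the integral: h_K and dV_K are unchanged, ⟪g u, g x⟫ = ⟪u, x⟫, and g comes
out of the integral by linearity. -/
lemma secondMoment_map (hC2 : IsC2OnSphere (supportFn K)) (hsymm : IsStronglySymmetric T K)
    (hint : Integrable (fun x => (supportFn K x ^ 2)⁻¹) (coneMeasure K))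
    {g : EuclideanSpace ℝ (Fin (n + 1)) ≃ₗᵢ[ℝ] EuclideanSpace ℝ (Fin (n + 1))}
    (hg : g ∈ symmetryGroup T) (u : EuclideanSpace ℝ (Fin (n + 1))) :
    secondMoment K hint (g u) = g (secondMoment K hint u) := by
  change ∫ x, ((supportFn K x ^ 2)⁻¹ * ⟪g u, x⟫) • x ∂coneMeasure K =
    g (∫ x, ((supportFn K x ^ 2)⁻¹ * ⟪u, x⟫) • x ∂coneMeasure K)
  rw [← (measurePreserving_coneMeasure hC2 hsymm hg).integral_comp
    (measurableEmbedding_linearIsometryEquiv g)]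
  refine Eq.trans ?_ (g.toContinuousLinearEquiv.integral_comp_comm _)
  refine integral_congr_ae ?_
  filter_upwards [ae_coneMeasure_mem_sphere K] with x hx
  rw [hsymm g hg x hx, g.inner_map_map]
  exact (map_smul g _ _).symm

end ConvexBodies

end StronglySymmetric

/-! ### The isotropy identity -/

open StronglySymmetric in
theorem theorem1p3 (n : ℕ) (hn : 2 ≤ n)
    (T : Set (EuclideanSpace ℝ (Fin (n + 1)))) (hT : StronglySymmetric.IsRegularPolytope T)
    (K : ConvexBody (EuclideanSpace ℝ (Fin (n + 1))))
    (hK : (interior (K : Set (EuclideanSpace ℝ (Fin (n + 1))))).Nonempty)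
    (hC2 : StronglySymmetric.IsC2OnSphere (StronglySymmetric.supportFn K))
    (hsymm : StronglySymmetric.IsStronglySymmetric T K) :
    Integrable (fun x => (StronglySymmetric.supportFn K x ^ 2)⁻¹)
        (StronglySymmetric.coneMeasure K) ∧
      ∀ α β : Fin (n + 1),
        ∫ x, x α * x β / StronglySymmetric.supportFn K x ^ 2 ∂(StronglySymmetric.coneMeasure K) =
          (if α = β then (1 : ℝ) else 0) / (n + 1) *
            ∫ x, (StronglySymmetric.supportFn K x ^ 2)⁻¹ ∂(StronglySymmetric.coneMeasure K) := by
  have hint := integrable_inv_sq_supportFn hn hT hK hC2 hsymm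
  refine ⟨hint, ?_⟩
  have hsa : (secondMoment K hint).IsSymmetric := fun u v => by
    rw [real_inner_comm, inner_secondMoment, inner_secondMoment]
    simp only [mul_comm]
  obtain ⟨c, hc⟩ := hT.exists_eq_smul_of_commute hsa
    fun g hg u => secondMoment_map hC2 hsymm hint hg u
  have hcoord : ∀ α β : Fin (n + 1),
      ∫ x, x α * x β / supportFn K x ^ 2 ∂coneMeasure K = if α = β then c else 0 := by
    intro α β
    have h := inner_secondMoment hint (EuclideanSpace.single α (1 : ℝ))
      (EuclideanSpace.single β (1 : ℝ))
    simpa [hc, eq_comm, inner_smul_right, EuclideanSpace.inner_single_left] using h.symm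
  have hintc : ∀ α : Fin (n + 1),
      Integrable (fun x => x α * x α / supportFn K x ^ 2) (coneMeasure K) := by
    intro α
    have h := (integrable_secondMoment hint (EuclideanSpace.single α (1 : ℝ))).const_inner
      (𝕜 := ℝ) (EuclideanSpace.single α (1 : ℝ))
    refine h.congr (Filter.Eventually.of_forall fun x => ?_)
    simp [inner_smul_right, EuclideanSpace.inner_single_left]
    ring
  -- On the sphere the squares of the coordinates sum to 1, so the total integral is the trace of
  -- the scalar operator c on a space of dimension n + 1.
  have htrace : ∫ x, (supportFn K x ^ 2)⁻¹ ∂coneMeasure K = (n + 1) * c := by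
    calc ∫ x, (supportFn K x ^ 2)⁻¹ ∂coneMeasure K
        = ∫ x, ∑ α, x α * x α / supportFn K x ^ 2 ∂coneMeasure K := by
          refine integral_congr_ae ?_
          filter_upwards [ae_coneMeasure_mem_sphere K] with x hx
          have hx1 : ‖x‖ = 1 := by simpa using hx
          have h1 := EuclideanSpace.real_norm_sq_eq x
          rw [hx1, one_pow] at h1
          simp only [← Finset.sum_div, ← pow_two, ← h1, one_div]
      _ = ∑ α, ∫ x, x α * x α / supportFn K x ^ 2 ∂coneMeasure K :=
          integral_finsetSum _ fun α _ => hintc α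
      _ = (n + 1) * c := by simp [hcoord]
  intro α β
  rw [hcoord, htrace]
  split_ifs
  · field_simp
  · simp
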